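/- Let $k$ be a field and let $A$ be a finite-dimensional associative unital $k$-algebra which is self-injective and has no semisimple blocks, i.e. $A$ is not isomorphic to a product $A_1\times A_2$ of algebras with $A_1$ nonzero and semisimple. Let $\varphi$ be a $k$-algebra automorphism of $A$. Let $\underline{\mathrm{mod}}\text{-}A$ be the stable category of finitely generated right $A$-modules (the quotient of the module category by the homomorphisms that factor through a projective module), and let $\underline{\mathrm{cycl}}\text{-}A$ be its full subcategory whose objects are the cyclic modules. Let $\underline{\mathrm{res}}^{\mathrm{cycl}}_\varphi$ be the endofunctor of $\underline{\mathrm{cycl}}\text{-}A$ induced by $M\mapsto M_\varphi$, where $M_\varphi$ is $M$ with the action $m*a=m\varphi(a)$. For right ideals $I,J$ of $A$ put $(J:I)=\{a\in A\mid aI\subseteq J\}$. Then $\underline{\mathrm{res}}^{\mathrm{cycl}}_\varphi$ is isomorphic to the identity functor if and only if there is a family $\{\xi_I\}$ of invertible elements of $A$, indexed by the proper nonzero right ideals $I$ of $A$, such that 1. $\varphi(I)=\xi_I I$ for every proper nonzero right ideal $I$; 2. $\varphi(a)\xi_I-\xi_J a\in(0:I)+\varphi(J)$ for all proper nonzero right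 ideals $I,J$ and all $a\in(J:I)$. Moreover, if $\{\xi_I\}$ is a family of invertible elements with properties 1 and 2, and $\{\xi'_I\}$ is a family of invertible elements with $\xi_I-\xi'_I\in(0:I)+\varphi(I)$ for all $I$, then properties 1 and 2 also hold for $\{\xi'_I\}$. -/

import Mathlib

open CategoryTheory

universe u v

namespace StableModule

section Algebras

variable (k : Type u) [Field k] (A : Type v) [Ring A] [Algebra k A]

/-- `A` is self-injective: the regular right module (a module over `Aᵐᵒᵖ`) is injective. -/
def IsSelfInjective (A : Type v) [Ring A] : Prop := Module.Injective Aᵐᵒᵖ A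

/-- `A` is not a product `A₁ × A₂` of algebras with `A₁` nonzero and semisimple. -/
def WithoutSemisimpleBlocks : Prop :=
  ∀ (A₁ A₂ : Type v) [Ring A₁] [Ring A₂] [Algebra k A₁] [Algebra k A₂],
    Nontrivial A₁ → IsSemisimpleRing A₁ → IsEmpty (A ≃ₐ[k] A₁ × A₂)

end Algebras

section StableCategory

variable (R : Type v) [Ring R]

/-- `f` belongs to `𝒫(M, N)`: it factors through a finitely generated projective module. -/
def FactorsThroughProjective {R : Type v} [Ring R] {M N : FGModuleCat.{v} R} (f : M ⟶ N) : Prop :=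
  ∃ (P : FGModuleCat.{v} R) (g : M ⟶ P) (h : P ⟶ N), Module.Projective R P ∧ g ≫ h = f

/-- Two homomorphisms are identified when their difference factors through a projective. -/
def stableRel : HomRel (FGModuleCat.{v} R) := fun _ _ f g => FactorsThroughProjective (f - g)

/-- The relation is a congruence, so that the morphisms of the quotient category below are
exactly the groups `Hom(M, N) / 𝒫(M, N)`. -/
instance stableRel_congruence : Congruence (stableRel R) where
  comp_left := by
    rintro X Y Z f g g' ⟨P, a, b, hP, h⟩
    exact ⟨P, f ≫ a, b, hP, by rw [Category.assoc, h, Preadditive.comp_sub]⟩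
  comp_right := by
    rintro X Y Z f f' g ⟨P, a, b, hP, h⟩
    exact ⟨P, a, b ≫ g, hP, by rw [← Category.assoc, h, Preadditive.sub_comp]⟩
  equivalence :=
    { refl := fun f => ⟨FGModuleCat.of R PUnit.{v + 1}, 0, 0, inferInstance, by simp⟩
      symm := by
        rintro f g ⟨P, a, b, hP, h⟩
        exact ⟨P, -a, b, hP, by rw [Preadditive.neg_comp, h, neg_sub]⟩
      trans := by
        rintro f g l ⟨P, a, b, hP, h⟩ ⟨Q, c, d, hQ, h'⟩
        refine ⟨FGModuleCat.of R (P × Q),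
          ObjectProperty.homMk (ModuleCat.ofHom (a.hom.hom.prod c.hom.hom)),
          ObjectProperty.homMk (ModuleCat.ofHom (b.hom.hom.coprod d.hom.hom)), ?_, ?_⟩
        · exact (inferInstance : Module.Projective R (P × Q))
        · rw [← sub_add_sub_cancel f g l, ← h, ← h']
          rfl }

/-- The stable category of finitely generated `R`-modules. -/
abbrev StableCat := CategoryTheory.Quotient (stableRel R)

/-- A module is cyclic if it is generated by one element. -/
def IsCyclicModule (M : FGModuleCat.{v} R) : Prop := ∃ x : M, Submodule.span R {x} = ⊤

/-- Cyclic modules, as a property of the objects of the stable category. -/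
def stableCyclic : ObjectProperty (StableCat R) := fun M => IsCyclicModule R M.as

/-- The stable cyclic module category: the full subcategory of the stable category whose objects
are the cyclic modules. -/
abbrev StableCyclicCat := (stableCyclic R).FullSubcategory

end StableCategory

section Restriction

variable {R : Type v} [Ring R] (σ : R ≃+* R)

lemma restrict_isFG (M : FGModuleCat.{v} R) :
    ModuleCat.isFG R ((ModuleCat.restrictScalars σ.toRingHom).obj M.obj) := by
  obtain ⟨s, hs⟩ := (M.property : Module.Finite R M.obj).fg_top
  refine ⟨⟨s, eq_top_iff.2 fun (x : M.obj) _ => ?_⟩⟩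
  have hx : x ∈ Submodule.span R (s : Set M.obj) := hs ▸ Submodule.mem_top
  induction hx using Submodule.span_induction with
  | mem y hy => exact Submodule.subset_span hy
  | zero => exact Submodule.zero_mem _
  | add y z _ _ hy hz => exact Submodule.add_mem _ (hy trivial) (hz trivial)
  | smul r y _ hy =>
    have h := Submodule.smul_mem _ (σ.symm r) (hy trivial)
    rw [ModuleCat.restrictScalars.smul_def'] at h
    simpa using h

/-- Restriction along a ring automorphism `σ`, on finitely generated modules: `r` acts on the
restricted module as `σ r` acts on the original one. -/
noncomputable def resFG : FGModuleCat.{v} R ⥤ FGModuleCat.{v} R :=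
  (ModuleCat.isFG R).lift
    ((ModuleCat.isFG R).ι ⋙ ModuleCat.restrictScalars σ.toRingHom) (restrict_isFG σ)

/-- The identity map of a module, as a semilinear equivalence onto the restricted module. -/
def resEquiv (M : FGModuleCat.{v} R) :
    letI := RingHomInvPair.of_ringEquiv σ.symm
    letI := RingHomInvPair.symm (σ.symm : R →+* R) (σ.symm.symm : R →+* R)
    M.obj ≃ₛₗ[(σ.symm : R →+* R)] ((resFG σ).obj M).obj :=
  letI := RingHomInvPair.of_ringEquiv σ.symm
  letI := RingHomInvPair.symm (σ.symm : R →+* R) (σ.symm.symm : R →+* R)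
  { toFun := fun x => x
    invFun := fun x => x
    left_inv := fun _ => rfl
    right_inv := fun _ => rfl
    map_add' := fun _ _ => rfl
    map_smul' := fun r (x : M.obj) =>
      (congrArg (fun t : R => (t • x : M.obj)) (σ.apply_symm_apply r)).symm }

lemma resFG_projective (P : FGModuleCat.{v} R) (hP : Module.Projective R P) :
    Module.Projective R ((resFG σ).obj P) :=
  letI := RingHomInvPair.of_ringEquiv σ.symm
  letI := RingHomInvPair.symm (σ.symm : R →+* R) (σ.symm.symm : R →+* R)
  haveI : Module.Projective R P.obj := hP
  Module.Projective.of_equiv (resEquiv σ P)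

lemma resFG_stableRel {M N : FGModuleCat.{v} R} {f g : M ⟶ N} (h : stableRel R f g) :
    stableRel R ((resFG σ).map f) ((resFG σ).map g) := by
  obtain ⟨P, a, b, hP, hab⟩ := h
  refine ⟨(resFG σ).obj P, (resFG σ).map a, (resFG σ).map b, resFG_projective σ P hP, ?_⟩
  rw [← Functor.map_comp, hab]
  rfl

lemma resFG_cyclic (M : FGModuleCat.{v} R) (hM : IsCyclicModule R M) :
    IsCyclicModule R ((resFG σ).obj M) := by
  obtain ⟨x, hx⟩ := hM
  refine ⟨resEquiv σ M x, eq_top_iff.2 fun (y : M.obj) _ => ?_⟩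
  obtain ⟨r, rfl⟩ := Submodule.mem_span_singleton.1
    (show y ∈ Submodule.span R {x} from hx ▸ Submodule.mem_top)
  exact Submodule.mem_span_singleton.2 ⟨σ.symm r, ((resEquiv σ M).map_smulₛₗ r x).symm⟩

/-- The functor induced by restriction on the stable category. -/
noncomputable def resStable : StableCat R ⥤ StableCat R :=
  CategoryTheory.Quotient.lift (stableRel R) (resFG σ ⋙ CategoryTheory.Quotient.functor (stableRel R))
    fun _ _ _ _ h => CategoryTheory.Quotient.sound (stableRel R) (resFG_stableRel σ h)

/-- The functor induced by restriction on the stable cyclic module category. -/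
noncomputable def resStableCyclic : StableCyclicCat R ⥤ StableCyclicCat R :=
  (stableCyclic R).lift ((stableCyclic R).ι ⋙ resStable σ)
    fun M => resFG_cyclic σ M.obj.as M.property

end Restriction

section RightIdeals

variable {k : Type u} [Field k] {A : Type v} [Ring A] [Algebra k A]

/-- `resCyclic φ` is the endofunctor of the stable category of cyclic right `A`-modules (that is,
`Aᵐᵒᵖ`-modules) induced by `M ↦ M_φ`, where `m * a = m φ(a)` in `M_φ`. -/
noncomputable def resCyclic (φ : A ≃ₐ[k] A) :
    StableCyclicCat Aᵐᵒᵖ ⥤ StableCyclicCat Aᵐᵒᵖ :=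
  resStableCyclic (RingEquiv.op φ.toRingEquiv)

variable (k) in
/-- A right ideal, viewed as a vector subspace. -/
def toSubspace (I : Submodule Aᵐᵒᵖ A) : Submodule k A := I.restrictScalars k

variable (k) in
/-- `(J : I) = {a ∈ A | a I ⊆ J}`, a vector subspace of `A`. -/
def colon (J I : Submodule Aᵐᵒᵖ A) : Submodule k A where
  carrier := {a | ∀ x ∈ I, a * x ∈ J}
  add_mem' := fun ha hb x hx => by rw [add_mul]; exact J.add_mem (ha x hx) (hb x hx)
  zero_mem' := fun x _ => by rw [zero_mul]; exact J.zero_mem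
  smul_mem' := fun c a ha x hx => by
    rw [smul_mul_assoc]; exact (toSubspace k J).smul_mem c (ha x hx)

/-- The image `φ(I)`, as a vector subspace of `A`. -/
def image (φ : A ≃ₐ[k] A) (I : Submodule Aᵐᵒᵖ A) : Submodule k A :=
  (toSubspace k I).map φ.toLinearMap

/-- The index set: proper nonzero right ideals. -/
abbrev ProperRightIdeal (A : Type v) [Ring A] : Type v :=
  {I : Submodule Aᵐᵒᵖ A // I ≠ ⊥ ∧ I ≠ ⊤}

/-- The two conditions on a family of units `ξ`: `φ(I) = ξ_I I` for all `I`, and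
`φ(a) ξ_I - ξ_J a ∈ (0 : I) + φ(J)` for all `I`, `J` and all `a ∈ (J : I)`. -/
def IsStableFamily (φ : A ≃ₐ[k] A) (ξ : ProperRightIdeal A → Aˣ) : Prop :=
  (∀ I : ProperRightIdeal A, φ '' (I.1 : Set A) = (fun x => (ξ I : A) * x) '' (I.1 : Set A)) ∧
  ∀ I J : ProperRightIdeal A, ∀ a ∈ colon k J.1 I.1,
    φ a * (ξ I : A) - (ξ J : A) * a ∈ colon k ⊥ I.1 ⊔ image φ J.1

end RightIdeals

end StableModule

/-! A homomorphism `A/I → A/J` is left multiplication by some `a ∈ (J : I)`, and it is stably zero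
exactly when `a ∈ (0 : I) + J` (`stableRel_iff`). Twisting `A/φ(I)` by `φ` gives `A/I`, so a natural
isomorphism has components `A/I → A/φ(I)` represented by elements `a_I`, and property 2 for the
`a_I` is naturality (`exists_family_of_iso`). Conversely, units with property 1 give genuine
isomorphisms `M_φ ≅ M`, and property 2 makes them natural in the stable category
(`nonempty_iso_of_isStableFamily`).

The difficulty is to find a unit in the coset of `a_I` modulo `(0 : I) + φ(I)`. Stable isomorphisms
do not see projective summands, so those of `A/I` and `A/φ(I)` must be compared separately. They are
measured by `e`, a right identity of `(0 : I)` modulo the radical, and by `φ(e)`. The comparison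
comes from the stable isomorphism at another ideal, `topKernel e`, whose quotient is the top of
`eA`. Self-injectivity and the absence of semisimple blocks force every `c` with `c · rad A = 0`
into the radical (`mem_jacobson_of_mul_jacobson_eq_zero`), so stable equalities between such tops
are genuine equalities modulo the radical. With the projective parts matched, `a_I` becomes right
invertible modulo the radical and `φ(I)`, and stable range one of Artinian rings supplies the unit
(`IsStableInverse.exists_unit`). -/

namespace StableModule

/-! ### Unit-regularity of semisimple rings and stable range one -/

section UnitRegular

/-- A ring is unit-regular if every element `a` can be written `a * w * a` with `w` a unit. -/
def IsUnitRegular (R : Type*) [Ring R] : Prop := ∀ a : R, ∃ w : Rˣ, a * w * a = a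

lemma IsUnitRegular.of_ringEquiv {R S : Type*} [Ring R] [Ring S] (e : R ≃+* S)
    (h : IsUnitRegular S) : IsUnitRegular R := fun a => by
  obtain ⟨w, hw⟩ := h (e a)
  refine ⟨Units.map e.symm.toMonoidHom w, e.injective ?_⟩
  simpa using hw

lemma IsUnitRegular.pi {ι : Type*} {R : ι → Type*} [∀ i, Ring (R i)]
    (h : ∀ i, IsUnitRegular (R i)) : IsUnitRegular (Π i, R i) := fun a => by
  choose w hw using fun i => h i (a i)
  exact ⟨MulEquiv.piUnits.symm w, funext hw⟩

/-- Choose `w` to invert `a` from its range to a complement of the kernel, and to identify a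
complement of the range with the kernel; the latter two have equal dimension. -/
lemma exists_linearEquiv_comp_comp_eq {D V : Type*} [DivisionRing D] [AddCommGroup V] [Module D V]
    [FiniteDimensional D V] (a : V →ₗ[D] V) : ∃ w : V ≃ₗ[D] V, a ∘ₗ w ∘ₗ a = a := by
  obtain ⟨K', hK⟩ := exists_isCompl (LinearMap.ker a)
  obtain ⟨R', hR⟩ := exists_isCompl (LinearMap.range a)
  have h1 := Submodule.finrank_add_eq_of_isCompl hR
  have h2 := LinearMap.finrank_range_add_finrank_ker a
  have e2 : R' ≃ₗ[D] LinearMap.ker a := LinearEquiv.ofFinrankEq _ _ (by omega)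
  let e1 := a.kerComplementEquivRange hK.symm
  let w := (Submodule.prodEquivOfIsCompl _ _ hR).symm ≪≫ₗ (e1.symm.prodCongr e2) ≪≫ₗ
    Submodule.prodEquivOfIsCompl _ _ hK.symm
  refine ⟨w, LinearMap.ext fun x => ?_⟩
  have hx : (Submodule.prodEquivOfIsCompl _ _ hR).symm (a x) = (⟨a x, x, rfl⟩, 0) :=
    Submodule.prodEquivOfIsCompl_symm_apply_left _ _ hR ⟨a x, x, rfl⟩
  have h3 : a (e1.symm ⟨a x, x, rfl⟩ : V) = a x :=
    congrArg Subtype.val (e1.apply_symm_apply ⟨a x, x, rfl⟩)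
  simp [w, hx, h3]

lemma isUnitRegular_matrix {n D : Type*} [Fintype n] [DecidableEq n] [DivisionRing D] :
    IsUnitRegular (Matrix n n D) := fun a => by
  obtain ⟨w, hw⟩ := exists_linearEquiv_comp_comp_eq (Matrix.toLinearMapRight' a)
  refine ⟨⟨LinearMap.toMatrixRight' (w : (n → D) →ₗ[D] (n → D)),
    LinearMap.toMatrixRight' (w.symm : (n → D) →ₗ[D] (n → D)), ?_, ?_⟩, ?_⟩
  · rw [← LinearMap.toMatrixRight'_comp]; simp
  · rw [← LinearMap.toMatrixRight'_comp]; simp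
  · apply Matrix.toLinearMapRight'.injective
    rw [Matrix.toLinearMapRight'_mul, Matrix.toLinearMapRight'_mul]
    simpa using hw

lemma isUnitRegular_of_isSemisimpleRing (R : Type*) [Ring R] [IsSemisimpleRing R] :
    IsUnitRegular R := by
  obtain ⟨n, D, d, _, _, ⟨e⟩⟩ := IsSemisimpleRing.exists_ringEquiv_pi_matrix_divisionRing R
  exact .of_ringEquiv e (.pi fun _ => isUnitRegular_matrix)

/-- Unit-regular rings have stable range one. -/
lemma IsUnitRegular.exists_isUnit_add {R : Type*} [Ring R] (h : IsUnitRegular R) {a b j : R}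
    (hab : a * b + j = 1) : ∃ y, IsUnit (a + j * y) := by
  obtain ⟨w, hw⟩ := h a
  -- `e` is idempotent and `a = e w⁻¹`. With `y = (1 - e) w⁻¹`, `a + j y = (e + j (1 - e)) w⁻¹`, and
  -- the first factor equals `1 + e j (1 - e)`, which is unipotent.
  set e := a * w with he
  have hee : e * e = e := by rw [he, ← mul_assoc, hw]
  have hj : (1 - e) * j = 1 - e := by
    have := congrArg (fun t => (1 - e) * t) hab
    simp only [mul_add, ← mul_assoc, sub_mul, one_mul, hw, sub_self, zero_mul, zero_add,
      mul_one] at this ⊢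
    exact this
  have hn : (e * j * (1 - e)) * (e * j * (1 - e)) = 0 := by
    have : (1 - e) * e = 0 := by rw [sub_mul, hee, one_mul, sub_self]
    calc _ = e * j * ((1 - e) * e) * (j * (1 - e)) := by simp only [mul_assoc]
      _ = 0 := by rw [this]; simp
  have hu : IsUnit (1 + e * j * (1 - e)) :=
    IsNilpotent.isUnit_one_add ⟨2, by rw [pow_two, hn]⟩
  have heq : e + j * (1 - e) = 1 + e * j * (1 - e) := by
    have h1 : (1 - e) * j * (1 - e) = 1 - e := by
      rw [hj, sub_mul, one_mul, mul_sub, mul_one, hee, sub_self, sub_zero]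
    rw [sub_mul 1 e j, sub_mul, one_mul, sub_eq_iff_eq_add] at h1
    rw [h1]
    abel
  refine ⟨(1 - e) * (w⁻¹ : Rˣ), ?_⟩
  have : a + j * ((1 - e) * (w⁻¹ : Rˣ)) = (e + j * (1 - e)) * (w⁻¹ : Rˣ) := by
    rw [add_mul, he, Units.mul_inv_cancel_right, mul_assoc]
  rw [this, heq]
  exact hu.mul (Units.isUnit _)

end UnitRegular

/-! ### Artinian rings modulo the Jacobson radical -/

section Radical

variable {A : Type v} [Ring A]

lemma mem_jacobson_of_mul_left {x : A} (a : A) (h : x ∈ Ring.jacobson A) :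
    a * x ∈ Ring.jacobson A := (Ring.jacobson A).mul_mem_left a h

lemma mem_jacobson_of_mul_right {x : A} (a : A) (h : x ∈ Ring.jacobson A) :
    x * a ∈ Ring.jacobson A := (Ring.jacobson A).mul_mem_right a h

lemma isUnit_of_sub_one_mem_jacobson [IsArtinianRing A] {x : A} (h : x - 1 ∈ Ring.jacobson A) :
    IsUnit x := by
  obtain ⟨n, hn⟩ := IsSemiprimaryRing.isNilpotent (R := A)
  have : IsNilpotent (x - 1) := ⟨n, by
    have := Ideal.pow_mem_pow h n
    rwa [hn] at this⟩
  simpa using this.isUnit_one_add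

lemma isUnit_of_isUnit_mk_jacobson [IsArtinianRing A] {x : A}
    (h : IsUnit (Ideal.Quotient.mk (Ring.jacobson A) x)) : IsUnit x := by
  obtain ⟨y, hy1, hy2⟩ := isUnit_iff_exists.1 h
  obtain ⟨y, rfl⟩ := Ideal.Quotient.mk_surjective y
  rw [← map_mul, ← map_one (Ideal.Quotient.mk (Ring.jacobson A)),
    Ideal.Quotient.mk_eq_mk_iff_sub_mem] at hy1 hy2
  have h1 := isUnit_of_sub_one_mem_jacobson hy1
  have h2 := isUnit_of_sub_one_mem_jacobson hy2
  obtain ⟨u, hu⟩ := h1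
  obtain ⟨w, hw⟩ := h2
  exact isUnit_iff_exists_and_exists.2
    ⟨⟨y * (u⁻¹ : Aˣ), by rw [← mul_assoc, ← hu, Units.mul_inv]⟩,
      ⟨(w⁻¹ : Aˣ) * y, by rw [mul_assoc, ← hw, Units.inv_mul]⟩⟩

/-- Artinian rings have stable range one. -/
lemma exists_isUnit_add_of_jacobson [IsArtinianRing A] {a b j : A}
    (h : a * b + j - 1 ∈ Ring.jacobson A) : ∃ y, IsUnit (a + j * y) := by
  have h' := (Ideal.Quotient.mk_eq_mk_iff_sub_mem _ _).2 h
  rw [map_add, map_mul, map_one] at h'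
  obtain ⟨y, hy⟩ := (isUnitRegular_of_isSemisimpleRing (A ⧸ Ring.jacobson A)).exists_isUnit_add h'
  obtain ⟨y, rfl⟩ := Ideal.Quotient.mk_surjective y
  exact ⟨y, isUnit_of_isUnit_mk_jacobson (by simpa using hy)⟩

/-- In the unit-regular quotient by the radical, `x = x w x`, and the right side vanishes. -/
lemma mem_jacobson_of_mul_mul_eq_zero [IsArtinianRing A] {x : A} (h : ∀ a, x * a * x = 0) :
    x ∈ Ring.jacobson A := by
  obtain ⟨w, hw⟩ := isUnitRegular_of_isSemisimpleRing (A ⧸ Ring.jacobson A)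
    (Ideal.Quotient.mk _ x)
  obtain ⟨y, hy⟩ := Ideal.Quotient.mk_surjective (w : A ⧸ Ring.jacobson A)
  rw [← hy, ← map_mul, ← map_mul, h, map_zero] at hw
  exact Ideal.Quotient.eq_zero_iff_mem.1 hw.symm

/-- Modulo the radical, a left ideal has a right identity. -/
lemma exists_right_identity_mod_jacobson [IsArtinianRing A] (L : Ideal A) :
    ∃ e ∈ L, ∀ c ∈ L, c - c * e ∈ Ring.jacobson A := by
  obtain ⟨e, he, hL⟩ := IsSemisimpleRing.ideal_eq_span_idempotent
    (L.map (Ideal.Quotient.mk (Ring.jacobson A)))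
  have hmem : e ∈ L.map (Ideal.Quotient.mk (Ring.jacobson A)) :=
    hL ▸ Ideal.mem_span_singleton_self e
  obtain ⟨e, heL, rfl⟩ := (Ideal.mem_map_iff_of_surjective _ Ideal.Quotient.mk_surjective).1 hmem
  refine ⟨e, heL, fun c hc => ?_⟩
  have h1 := hL ▸ Ideal.mem_map_of_mem (Ideal.Quotient.mk (Ring.jacobson A)) hc
  obtain ⟨y, hy⟩ := Ideal.mem_span_singleton'.1 h1
  rw [← Ideal.Quotient.mk_eq_mk_iff_sub_mem, map_mul, ← hy, mul_assoc, he.eq]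

/-- Modulo the radical, a right ideal has a left identity. -/
lemma exists_left_identity_mod_jacobson [IsArtinianRing A] (U : Submodule Aᵐᵒᵖ A) :
    ∃ h ∈ U, ∀ y ∈ U, y - h * y ∈ Ring.jacobson A := by
  let π := Ideal.Quotient.mk (Ring.jacobson A)
  let V : Ideal (A ⧸ Ring.jacobson A)ᵐᵒᵖ :=
    { carrier := {x | ∃ y ∈ U, π y = x.unop}
      add_mem' := by
        rintro _ _ ⟨y, hy, h⟩ ⟨z, hz, h'⟩
        exact ⟨y + z, U.add_mem hy hz, by rw [map_add, h, h', MulOpposite.unop_add]⟩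
      zero_mem' := ⟨0, U.zero_mem, by simp⟩
      smul_mem' := by
        rintro c _ ⟨y, hy, h⟩
        obtain ⟨z, hz⟩ := Ideal.Quotient.mk_surjective c.unop
        exact ⟨y * z, U.smul_mem (MulOpposite.op z) hy, by
          rw [map_mul, h, smul_eq_mul, MulOpposite.unop_mul, ← hz]⟩ }
  obtain ⟨e, he, hV⟩ := IsSemisimpleRing.ideal_eq_span_idempotent V
  obtain ⟨h, hU, hh⟩ : e ∈ V := hV ▸ Ideal.mem_span_singleton_self e
  refine ⟨h, hU, fun y hy => ?_⟩
  have h1 : MulOpposite.op (π y) ∈ V := ⟨y, hy, rfl⟩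
  rw [hV] at h1
  obtain ⟨z, hz⟩ := Ideal.mem_span_singleton'.1 h1
  rw [← Ideal.Quotient.mk_eq_mk_iff_sub_mem, map_mul]
  change π y = π h * π y
  have : π y = e.unop * z.unop := by rw [← MulOpposite.unop_mul, hz]; rfl
  rw [hh, this, ← mul_assoc, ← MulOpposite.unop_mul e e, he.eq]

end Radical

/-! ### Self-injectivity and the socle -/

section SelfInjective

variable {A : Type v} [Ring A]

/-- Left multiplication, as an endomorphism of the regular right module. -/
def mulLeftHom (a : A) : A →ₗ[Aᵐᵒᵖ] A where
  toFun x := a * x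
  map_add' := mul_add a
  map_smul' := fun r x => (mul_assoc a x r.unop).symm

@[simp] lemma mulLeftHom_apply (a x : A) : mulLeftHom a x = a * x := rfl

/-- Over a self-injective ring, inclusion of right annihilators implies left divisibility. -/
lemma IsSelfInjective.exists_mul_eq (hA : IsSelfInjective A) {s t : A}
    (h : ∀ y, s * y = 0 → t * y = 0) : ∃ z, z * s = t := by
  have hk : LinearMap.ker (mulLeftHom s) ≤ LinearMap.ker (mulLeftHom t) := h
  obtain ⟨g, hg⟩ := Module.Injective.out (self := hA)
    ((LinearMap.ker (mulLeftHom s)).liftQ (mulLeftHom s) le_rfl)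
    (LinearMap.ker_eq_bot.1 (Submodule.ker_liftQ_eq_bot' _ _ rfl))
    ((LinearMap.ker (mulLeftHom s)).liftQ (mulLeftHom t) hk)
  have h1 := hg (Submodule.Quotient.mk 1)
  simp only [Submodule.liftQ_apply, mulLeftHom_apply, mul_one] at h1
  refine ⟨g 1, ?_⟩
  rw [← h1]
  simpa using (g.map_smul (MulOpposite.op s) 1).symm

/-- A nonzero such `e` would split off the block `Ae`, a quotient of `A / rad A` and hence
semisimple. -/
lemma eq_zero_of_central_idempotent {k : Type u} [Field k] [Algebra k A]
    (hblocks : WithoutSemisimpleBlocks k A) {e : A} [IsArtinianRing A] (hee : e * e = e)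
    (hc : ∀ a, e * a = a * e) (hr : ∀ x ∈ Ring.jacobson A, e * x = 0) : e = 0 := by
  by_contra hne
  let I₁ : Ideal A := LinearMap.ker (LinearMap.toSpanSingleton A A e)
  let I₂ : Ideal A := LinearMap.ker (LinearMap.toSpanSingleton A A (1 - e))
  have m₁ : ∀ x, x ∈ I₁ ↔ x * e = 0 := fun x => Iff.rfl
  have m₂ : ∀ x, x ∈ I₂ ↔ x * (1 - e) = 0 := fun x => Iff.rfl
  have : I₁.IsTwoSided := ⟨fun b ha => by
    rw [m₁] at ha ⊢; rw [mul_assoc, ← hc, ← mul_assoc, ha, zero_mul]⟩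
  have : I₂.IsTwoSided := ⟨fun {a} b ha => by
    rw [m₂] at ha ⊢
    rw [show a * b * (1 - e) = a * (1 - e) * b by
      simp only [mul_sub, sub_mul, mul_one, mul_assoc, hc], ha, zero_mul]⟩
  have hle : Ring.jacobson A ≤ I₁ := fun x hx => by rw [m₁, ← hc, hr x hx]
  have hss : IsSemisimpleRing (A ⧸ I₁) :=
    (Ideal.Quotient.factor hle).isSemisimpleRing_of_surjective
      (Ideal.Quotient.factor_surjective hle)
  have hnt : Nontrivial (A ⧸ I₁) := Ideal.Quotient.nontrivial_iff.2 fun h => hne <| by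
    have := (m₁ 1).1 (h ▸ Submodule.mem_top)
    rwa [one_mul] at this
  refine (hblocks (A ⧸ I₁) (A ⧸ I₂) hnt hss).false
    (AlgEquiv.ofBijective ((Ideal.Quotient.mkₐ k I₁).prod (Ideal.Quotient.mkₐ k I₂)) ⟨?_, ?_⟩)
  · rw [injective_iff_map_eq_zero]
    intro x hx
    have h1 := (m₁ x).1 (Ideal.Quotient.eq_zero_iff_mem.1 (congrArg Prod.fst hx))
    have h2 := (m₂ x).1 (Ideal.Quotient.eq_zero_iff_mem.1 (congrArg Prod.snd hx))
    rwa [mul_sub, h1, mul_one, sub_zero] at h2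
  · rintro ⟨x, y⟩
    obtain ⟨x, rfl⟩ := Ideal.Quotient.mk_surjective x
    obtain ⟨y, rfl⟩ := Ideal.Quotient.mk_surjective y
    refine ⟨x * e + y * (1 - e), Prod.ext ?_ ?_⟩
    · refine (Ideal.Quotient.mk_eq_mk_iff_sub_mem _ _).2 ((m₁ _).2 ?_)
      simp [sub_mul, add_mul, mul_sub, mul_assoc, hee]
    · refine (Ideal.Quotient.mk_eq_mk_iff_sub_mem _ _).2 ((m₂ _).2 ?_)
      simp [sub_mul, add_mul, mul_sub, mul_assoc, hee]
      abel

/-- Without semisimple blocks, the right socle of a self-injective algebra lies in the radical. -/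
lemma mem_jacobson_of_mul_jacobson_eq_zero {k : Type u} [Field k] [Algebra k A]
    [IsArtinianRing A] (hA : IsSelfInjective A) (hblocks : WithoutSemisimpleBlocks k A) {c : A}
    (hc : ∀ x ∈ Ring.jacobson A, c * x = 0) : c ∈ Ring.jacobson A := by
  let T : Ideal A :=
    { carrier := {t | ∀ x ∈ Ring.jacobson A, t * x = 0}
      add_mem' := fun hs ht x hx => by rw [add_mul, hs x hx, ht x hx, add_zero]
      zero_mem' := fun x _ => zero_mul x
      smul_mem' := fun a t ht x hx => by rw [smul_eq_mul, mul_assoc, ht x hx, mul_zero] }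
  obtain ⟨e₀, he₀, hT₀⟩ := exists_right_identity_mod_jacobson T
  obtain ⟨e, heT, hee, hTe⟩ : ∃ e ∈ T, e * e = e ∧ ∀ t ∈ T, t - t * e ∈ Ring.jacobson A := by
    -- `e₀` kills the radical, so `e₀² = e₀³` and `e₀²` is a true idempotent.
    have h3 : e₀ * (e₀ - e₀ * e₀) = 0 := he₀ _ (hT₀ e₀ he₀)
    rw [mul_sub, sub_eq_zero] at h3
    refine ⟨e₀ * e₀, T.mul_mem_left _ he₀, ?_, fun t ht => ?_⟩
    · rw [mul_assoc, ← h3, ← h3]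
    · have := add_mem (hT₀ t ht) (hT₀ _ (T.mul_mem_left t he₀))
      rwa [sub_add_sub_cancel, mul_assoc] at this
  -- With `h` a left identity modulo the radical of the right annihilator of `x e`, that annihilator
  -- also kills `e (1 - h)`. Self-injectivity makes `e (1 - h)` a left multiple of `x e`, hence
  -- radical, so `e` kills it; but `x e = x e (1 - h)`.
  have h1 : ∀ x, x * e ∈ Ring.jacobson A → x * e = 0 := by
    intro x hx
    obtain ⟨h, hU, hh⟩ := exists_left_identity_mod_jacobson (LinearMap.ker (mulLeftHom (x * e)))
    have hxh : x * e * h = 0 := hU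
    obtain ⟨z, hz⟩ := hA.exists_mul_eq (s := x * e) (t := e * (1 - h)) fun y hy => by
      rw [mul_assoc, sub_mul, one_mul]; exact heT _ (hh y hy)
    have h2 : e * (1 - h) ∈ Ring.jacobson A := hz ▸ mem_jacobson_of_mul_left z hx
    have h3 := heT _ h2
    rw [← mul_assoc, hee] at h3
    calc x * e = x * (e * (1 - h)) := by rw [mul_sub, mul_one, mul_sub, ← mul_assoc, hxh, sub_zero]
      _ = 0 := by rw [h3, mul_zero]
  have h2 : ∀ a, e * a = e * a * e := by
    intro a
    have h := hTe (e * a) fun x hx => by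
      rw [mul_assoc]; exact heT _ (mem_jacobson_of_mul_left a hx)
    have h' := heT _ h
    rw [mul_sub, ← mul_assoc, ← mul_assoc, ← mul_assoc, hee] at h'
    exact sub_eq_zero.1 h'
  -- `x = (a - e a) e` satisfies `e x = 0`, so `x b x = 0` for all `b` because `e b = e b e`. Thus
  -- `x` is radical and `h1` applies; together with `h2`, `e` is central.
  have h3 : ∀ a, a * e = e * a * e := by
    intro a
    have hx : a * e - e * a * e = (a - e * a) * e := by rw [sub_mul]
    have hex : e * ((a - e * a) * e) = 0 := by
      rw [← mul_assoc, mul_sub, ← mul_assoc, hee, sub_self, zero_mul]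
    rw [← sub_eq_zero, hx]
    refine h1 _ (mem_jacobson_of_mul_mul_eq_zero fun b => ?_)
    calc (a - e * a) * e * b * ((a - e * a) * e)
        = (a - e * a) * (e * b) * ((a - e * a) * e) := by simp only [mul_assoc]
      _ = (a - e * a) * (e * b * e) * ((a - e * a) * e) := by rw [← h2 b]
      _ = (a - e * a) * (e * b) * (e * ((a - e * a) * e)) := by simp only [mul_assoc]
      _ = 0 := by rw [hex, mul_zero]
  have he : e = 0 := eq_zero_of_central_idempotent hblocks hee
    (fun a => (h2 a).trans (h3 a).symm) heT
  simpa [he] using hTe c hc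

end SelfInjective

/-! ### From stable isomorphisms to units -/

section StableInverse

variable {A : Type v} [Ring A]

/-- Left multiplication by `a` and by `b` induce maps `A/I → A/J` and `A/J → A/I` such that the
composite on `A/J` is stably the identity. -/
structure IsStableInverse (I J : Submodule Aᵐᵒᵖ A) (a b : A) : Prop where
  mul_mem : ∀ x ∈ I, a * x ∈ J
  mul_mem' : ∀ x ∈ J, b * x ∈ I
  mul_eq : ∃ c j, (∀ x ∈ J, c * x = 0) ∧ j ∈ J ∧ a * b = 1 + c + j

lemma rightIdeal_mul_mem (J : Submodule Aᵐᵒᵖ A) {x : A} (hx : x ∈ J) (a : A) : x * a ∈ J :=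
  J.smul_mem (MulOpposite.op a) hx

/-- For `e` idempotent modulo the radical, the right ideal `(1 - e) A + rad A`, whose quotient is
the top of `e A`. -/
def topKernel (e : A) : Submodule Aᵐᵒᵖ A where
  carrier := {x | e * x ∈ Ring.jacobson A}
  add_mem' := fun hx hy => by
    rw [Set.mem_ofPred_eq, mul_add]; exact add_mem hx hy
  zero_mem' := by simp
  smul_mem' := fun c x hx => by
    change e * (x * c.unop) ∈ Ring.jacobson A
    rw [← mul_assoc]; exact mem_jacobson_of_mul_right _ hx

lemma mem_topKernel {e x : A} : x ∈ topKernel e ↔ e * x ∈ Ring.jacobson A := Iff.rfl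

lemma one_sub_mem_topKernel {e : A} (he : e - e * e ∈ Ring.jacobson A) : 1 - e ∈ topKernel e := by
  rwa [mem_topKernel, mul_sub, mul_one]

/-- The error term `c` kills `topKernel f`, which contains the radical, so `hss` makes it radical.
Modulo the radical, the stable inverse is therefore an actual one: the top of `fA` is a retract of
the top of `eA`. -/
lemma IsStableInverse.topKernel_mul (hss : ∀ c : A, (∀ x ∈ Ring.jacobson A, c * x = 0) →
      c ∈ Ring.jacobson A) {e f a b : A} (he : e - e * e ∈ Ring.jacobson A)
    (hf : f - f * f ∈ Ring.jacobson A) (h : IsStableInverse (topKernel e) (topKernel f) a b) :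
    (f * a * e) * (e * b * f) - f ∈ Ring.jacobson A := by
  obtain ⟨c, j, hc, hj, hab⟩ := h.mul_eq
  have hc' : c ∈ Ring.jacobson A := hss c fun x hx => hc x (mem_jacobson_of_mul_left f hx)
  have h1 := h.mul_mem _ (one_sub_mem_topKernel he)
  rw [mem_topKernel, ← Ideal.Quotient.eq_zero_iff_mem] at h1 hj
  rw [← Ideal.Quotient.eq_zero_iff_mem] at he hf hc' ⊢
  have hab' := congrArg (Ideal.Quotient.mk (Ring.jacobson A)) hab
  simp only [map_mul, map_sub, map_add, map_one, hc'] at h1 hj he hf hab' ⊢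
  generalize (Ideal.Quotient.mk (Ring.jacobson A)) a = a at *
  generalize (Ideal.Quotient.mk (Ring.jacobson A)) b = b at *
  generalize (Ideal.Quotient.mk (Ring.jacobson A)) e = e at *
  generalize (Ideal.Quotient.mk (Ring.jacobson A)) f = f at *
  generalize (Ideal.Quotient.mk (Ring.jacobson A)) j = j at *
  have e1 : e * e = e := (sub_eq_zero.1 he).symm
  have f1 : f * f = f := (sub_eq_zero.1 hf).symm
  have h2 : f * a * e = f * a := by
    rw [mul_sub, mul_one, mul_sub, sub_eq_zero] at h1
    rw [mul_assoc, ← h1]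
  have h3 : f * (a * b) = f := by rw [hab', mul_add, hj, add_zero, add_zero, mul_one]
  rw [h2, mul_assoc e b f, ← mul_assoc (f * a) e, h2, ← mul_assoc, mul_assoc f a b, h3, f1,
    sub_self]

/-- A stable isomorphism `A/I → A/J` lifts to a unit, provided the projective summands of `A/I` and
`A/J` agree: they are given by `e` and `f`, and `u`, `v` compare them. -/
lemma IsStableInverse.exists_unit [IsArtinianRing A] {I J : Submodule Aᵐᵒᵖ A} {a b e f u v : A}
    (h : IsStableInverse I J a b) (heI : ∀ x ∈ I, e * x = 0) (hfJ : ∀ x ∈ J, f * x = 0)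
    (he : e - e * e ∈ Ring.jacobson A)
    (hf : ∀ t, (∀ x ∈ J, t * x = 0) → t - t * f ∈ Ring.jacobson A)
    (huv : (u * e) * (e * v) - f ∈ Ring.jacobson A) :
    ∃ ξ : Aˣ, ∃ c j, (∀ x ∈ I, c * x = 0) ∧ j ∈ J ∧ (ξ : A) = a + c + j := by
  obtain ⟨c, j, hc, hj, hab⟩ := h.mul_eq
  -- Modulo the radical, `u` and `v` replace `a` and `b` on the projective parts. Both `e b` and `c`
  -- kill `J`, so they vanish on `1 - f`; of the error terms only `j (1 - f)` survives.
  have hkey : ((1 - f) * a * (1 - e) + u * e) * ((1 - e) * b * (1 - f) + e * v) + -(j * (1 - f)) - 1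
      ∈ Ring.jacobson A := by
    have h1 := hf (e * b) fun x hx => by rw [mul_assoc]; exact heI _ (h.mul_mem' x hx)
    have h2 := hf c hc
    have h3 := hf f hfJ
    have h4 := hfJ j hj
    have h4' := congrArg (Ideal.Quotient.mk (Ring.jacobson A)) h4
    have hab' := congrArg (Ideal.Quotient.mk (Ring.jacobson A)) hab
    rw [← Ideal.Quotient.eq_zero_iff_mem] at he huv h1 h2 h3 ⊢
    simp only [map_mul, map_sub, map_add, map_one, map_neg, map_zero] at he huv h1 h2 h3 h4' hab' ⊢
    generalize (Ideal.Quotient.mk (Ring.jacobson A)) a = a at *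
    generalize (Ideal.Quotient.mk (Ring.jacobson A)) b = b at *
    generalize (Ideal.Quotient.mk (Ring.jacobson A)) c = c at *
    generalize (Ideal.Quotient.mk (Ring.jacobson A)) e = e at *
    generalize (Ideal.Quotient.mk (Ring.jacobson A)) f = f at *
    generalize (Ideal.Quotient.mk (Ring.jacobson A)) j = j at *
    generalize (Ideal.Quotient.mk (Ring.jacobson A)) u = u at *
    generalize (Ideal.Quotient.mk (Ring.jacobson A)) v = v at *
    linear_combination (norm := noncomm_ring) (1 - f) * hab' * (1 - f) + huv
      - (1 - f) * a * he * b * (1 - f) - (1 - f) * a * h1 + (1 - f) * a * he * v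
      + u * he * b * (1 - f) + (1 - f) * h2 - h3 - h4' * (1 - f)
  obtain ⟨y, hy⟩ := exists_isUnit_add_of_jacobson hkey
  obtain ⟨ξ, hξ⟩ := hy
  -- The second entry is the change from `a` to the modified element; it kills `I` since `e I = 0`
  -- and `f a I ⊆ f J = 0`. The third is the stable range correction, which lies in `J`.
  refine ⟨ξ, -(a * e) - f * a * (1 - e) + u * e, -(j * (1 - f)) * y, fun x hx => ?_, ?_, ?_⟩
  · have h1 := heI x hx
    have h2 := hfJ _ (h.mul_mem x hx)
    linear_combination (norm := noncomm_ring) (-a + f * a + u) * h1 - h2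
  · exact rightIdeal_mul_mem J (J.neg_mem (rightIdeal_mul_mem J hj _)) _
  · rw [hξ]; noncomm_ring

end StableInverse

/-! ### Images of right ideals under the automorphism -/

section Twist

variable {k : Type u} [Field k] {A : Type v} [Ring A] [Algebra k A] (φ : A ≃ₐ[k] A)

/-- The image `φ(I)` of a right ideal, as a right ideal. -/
def rightImage (I : Submodule Aᵐᵒᵖ A) : Submodule Aᵐᵒᵖ A where
  carrier := {x | φ.symm x ∈ I}
  add_mem' := fun hx hy => by
    rw [Set.mem_ofPred_eq, map_add]; exact I.add_mem hx hy
  zero_mem' := by simp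
  smul_mem' := fun c x hx => by
    change φ.symm (x * c.unop) ∈ I
    rw [map_mul]; exact rightIdeal_mul_mem I hx _

lemma mem_rightImage {I : Submodule Aᵐᵒᵖ A} {x : A} : x ∈ rightImage φ I ↔ φ.symm x ∈ I := Iff.rfl

lemma apply_mem_rightImage {I : Submodule Aᵐᵒᵖ A} {x : A} : φ x ∈ rightImage φ I ↔ x ∈ I := by
  rw [mem_rightImage, AlgEquiv.symm_apply_apply]

lemma mem_image_iff {I : Submodule Aᵐᵒᵖ A} {x : A} : x ∈ image φ I ↔ x ∈ rightImage φ I := by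
  constructor
  · rintro ⟨y, hy, rfl⟩
    exact (apply_mem_rightImage φ).2 hy
  · exact fun h => ⟨φ.symm x, h, φ.apply_symm_apply x⟩

lemma apply_mem_jacobson {x : A} (hx : x ∈ Ring.jacobson A) : φ x ∈ Ring.jacobson A := by
  have : RingHomSurjective (φ : A →+* A) := ⟨φ.surjective⟩
  exact Ring.le_comap_jacobson (φ : A →+* A) hx

lemma mem_colon_sup_image {I J : Submodule Aᵐᵒᵖ A} {x : A} :
    x ∈ colon k ⊥ I ⊔ image φ J ↔
      ∃ c j, (∀ y ∈ I, c * y = 0) ∧ j ∈ rightImage φ J ∧ x = c + j := by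
  rw [Submodule.mem_sup]
  constructor
  · rintro ⟨c, hc, j, hj, rfl⟩
    exact ⟨c, j, hc, (mem_image_iff φ).1 hj, rfl⟩
  · rintro ⟨c, j, hc, hj, rfl⟩
    exact ⟨c, hc, j, (mem_image_iff φ).2 hj, rfl⟩

lemma rightImage_topKernel (e : A) : rightImage φ (topKernel e) = topKernel (φ e) := by
  ext x
  rw [mem_rightImage, mem_topKernel, mem_topKernel]
  constructor
  · intro h
    simpa using apply_mem_jacobson φ h
  · intro h
    simpa using apply_mem_jacobson φ.symm h

/-- If `A/I` and `A/φ(I)` are compatibly stably isomorphic for all proper nonzero `I`, then these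
isomorphisms are induced by units. -/
lemma exists_unit_of_isStableInverse [IsArtinianRing A]
    (hss : ∀ c : A, (∀ x ∈ Ring.jacobson A, c * x = 0) → c ∈ Ring.jacobson A)
    {a b : ProperRightIdeal A → A}
    (h : ∀ I, IsStableInverse I.1 (rightImage φ I.1) (a I) (b I)) (I : ProperRightIdeal A) :
    ∃ ξ : Aˣ, (ξ : A) - a I ∈ colon k ⊥ I.1 ⊔ image φ I.1 := by
  let L : Ideal A :=
    { carrier := {t | ∀ x ∈ I.1, t * x = 0}
      add_mem' := fun hs ht x hx => by rw [add_mul, hs x hx, ht x hx, add_zero]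
      zero_mem' := fun x _ => zero_mul x
      smul_mem' := fun a t ht x hx => by rw [smul_eq_mul, mul_assoc, ht x hx, mul_zero] }
  obtain ⟨e, heL, hL⟩ := exists_right_identity_mod_jacobson L
  have he := hL e heL
  have hf : φ e - φ e * φ e ∈ Ring.jacobson A := by simpa using apply_mem_jacobson φ he
  -- The hypothesis is used at the ideal `topKernel e` rather than at `I`. That ideal is proper and
  -- nonzero unless `e` is radical, in which case there is nothing to compare.
  obtain ⟨u, v, huv⟩ : ∃ u v, (u * e) * (e * v) - φ e ∈ Ring.jacobson A := by
    by_cases her : e ∈ Ring.jacobson A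
    · exact ⟨0, 0, by simpa using apply_mem_jacobson φ her⟩
    · have h0 : topKernel e ≠ ⊥ := fun h0 => by
        have hr : Ring.jacobson A = ⊥ := eq_bot_iff.2 fun x hx => by
          have : x ∈ topKernel e := mem_jacobson_of_mul_left e hx
          rwa [h0] at this
        have h1 := hss 1 fun x hx => by rw [hr] at hx; rw [one_mul]; exact hx
        exact her (by simpa using mem_jacobson_of_mul_left e h1)
      have h1 : topKernel e ≠ ⊤ := fun h1 => her <| by
        have : (1 : A) ∈ topKernel e := h1 ▸ Submodule.mem_top
        rwa [mem_topKernel, mul_one] at this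
      have h2 := h ⟨topKernel e, h0, h1⟩
      simp only [rightImage_topKernel] at h2
      have h3 := h2.topKernel_mul hss he hf
      exact ⟨_, _, by rw [mul_assoc e] at h3; exact h3⟩
  obtain ⟨ξ, c, j, hc, hj, hξ⟩ := (h I).exists_unit heL (f := φ e) (fun x hx => by
      simpa using congrArg φ (heL _ hx)) he (fun t ht => by
      have := apply_mem_jacobson φ (hL (φ.symm t) fun x hx => by
        apply φ.injective
        simpa using ht _ ((apply_mem_rightImage φ).2 hx))
      simpa using this) huv
  exact ⟨ξ, (mem_colon_sup_image φ).2 ⟨c, j, hc, hj, by rw [hξ]; abel⟩⟩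

variable [Module.Finite k A]

/-- The inclusion `ξ I ⊆ φ(I)` is an equality because both sides have the dimension of `I`. -/
lemma image_eq_unit_mul (ξ : Aˣ) {I : Submodule Aᵐᵒᵖ A}
    (h : ∀ x ∈ I, (ξ : A) * x ∈ rightImage φ I) :
    φ '' (I : Set A) = (fun x => (ξ : A) * x) '' (I : Set A) := by
  have hle : (toSubspace k I).map (LinearMap.mulLeft k (ξ : A)) ≤ image φ I := by
    rintro _ ⟨x, hx, rfl⟩
    exact (mem_image_iff φ).2 (h x hx)
  have heq := Submodule.eq_of_le_of_finrank_eq hle (by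
    exact ((toSubspace k I).equivMapOfInjective (LinearMap.mulLeft k (ξ : A))
        fun _ _ hxy => ξ.mul_right_inj.1 hxy).finrank_eq.symm.trans
      ((toSubspace k I).equivMapOfInjective φ.toLinearMap φ.injective).finrank_eq)
  exact (congrArg (fun S : Submodule k A => (S : Set A)) heq).symm

/-- A family of units with the second property which maps `I` into `φ(I)` may be changed by elements
of `(0 : I) + φ(I)`. -/
lemma isStableFamily_of_sub_mem {a : ProperRightIdeal A → A} {ξ : ProperRightIdeal A → Aˣ}
    (ha : ∀ I : ProperRightIdeal A, ∀ x ∈ I.1, a I * x ∈ rightImage φ I.1)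
    (ha' : ∀ I J : ProperRightIdeal A, ∀ c ∈ colon k J.1 I.1,
      φ c * a I - a J * c ∈ colon k ⊥ I.1 ⊔ image φ J.1)
    (h : ∀ I, (ξ I : A) - a I ∈ colon k ⊥ I.1 ⊔ image φ I.1) : IsStableFamily φ ξ := by
  refine ⟨fun I => image_eq_unit_mul φ _ fun x hx => ?_, fun I J c hc => ?_⟩
  · obtain ⟨n, j, hn, hj, hξ⟩ := (mem_colon_sup_image φ).1 (h I)
    rw [sub_eq_iff_eq_add.1 hξ, add_mul, add_mul, hn x hx, zero_add]
    exact add_mem (rightIdeal_mul_mem _ hj x) (ha I x hx)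
  · obtain ⟨n, i, hn, hi, hξ⟩ := (mem_colon_sup_image φ).1 (h I)
    obtain ⟨n', j, hn', hj, hξ'⟩ := (mem_colon_sup_image φ).1 (h J)
    obtain ⟨m, l, hm, hl, hml⟩ := (mem_colon_sup_image φ).1 (ha' I J c hc)
    refine (mem_colon_sup_image φ).2 ⟨m + φ c * n - n' * c, l + φ c * i - j * c, fun x hx => ?_,
      sub_mem (add_mem hl ?_) (rightIdeal_mul_mem _ hj c), ?_⟩
    · rw [sub_mul, add_mul, hm x hx, mul_assoc, hn x hx, mul_assoc, hn' _ (hc x hx)]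
      simp
    · have := hc _ hi
      rw [mem_rightImage, map_mul, AlgEquiv.symm_apply_apply]
      exact this
    · linear_combination (norm := noncomm_ring) hml + φ c * hξ - hξ' * c

end Twist

/-! ### Stable homomorphisms between cyclic modules -/

section StableHom

variable {A : Type v} [Ring A]

lemma mul_eq_smul (x y : A) : x * y = MulOpposite.op y • x := rfl

instance finite_self_mulOpposite : Module.Finite Aᵐᵒᵖ A :=
  ⟨⟨{1}, eq_top_iff.2 fun x _ => by
    rw [Finset.coe_singleton, Submodule.mem_span_singleton]
    exact ⟨MulOpposite.op x, one_mul x⟩⟩⟩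

lemma exists_linearMap_comp_eq {X Y : Type v} [AddCommGroup X] [AddCommGroup Y] [Module Aᵐᵒᵖ X]
    [Module Aᵐᵒᵖ Y] {p : A →ₗ[Aᵐᵒᵖ] X} (hp : Function.Surjective p) (s : A →ₗ[Aᵐᵒᵖ] Y)
    (h : ∀ x, p x = 0 → s x = 0) : ∃ g : X →ₗ[Aᵐᵒᵖ] Y, ∀ x, g (p x) = s x := by
  refine ⟨(LinearMap.ker p).liftQ s h ∘ₗ (p.quotKerEquivOfSurjective hp).symm, fun x => ?_⟩
  have : (p.quotKerEquivOfSurjective hp).symm (p x) = Submodule.Quotient.mk x :=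
    (LinearEquiv.symm_apply_eq _).2 rfl
  rw [LinearMap.comp_apply, LinearEquiv.coe_coe, this]
  rfl

lemma map_mul_right {X : Type*} [AddCommGroup X] [Module Aᵐᵒᵖ X] (p : A →ₗ[Aᵐᵒᵖ] X) (x y : A) :
    p (x * y) = MulOpposite.op y • p x := p.map_smul (MulOpposite.op y) x

lemma linearMap_apply_eq {X Y : Type*} [AddCommGroup X] [Module Aᵐᵒᵖ X] [AddCommGroup Y]
    [Module Aᵐᵒᵖ Y] {p : A →ₗ[Aᵐᵒᵖ] X} {q : A →ₗ[Aᵐᵒᵖ] Y} {f : X →ₗ[Aᵐᵒᵖ] Y} {t : A}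
    (h : f (p 1) = q t) (x : A) : f (p x) = q (t * x) := by
  rw [map_mul_right, ← h, ← map_smul, ← map_mul_right, one_mul]

/-- Two homomorphisms between cyclic modules `A/I → A/J` agree stably if and only if they differ by
an element of `(0 : I) + J`. -/
lemma stableRel_iff {X Y : FGModuleCat.{v} Aᵐᵒᵖ} {p : A →ₗ[Aᵐᵒᵖ] X.obj} {q : A →ₗ[Aᵐᵒᵖ] Y.obj}
    (hp : Function.Surjective p) (hq : Function.Surjective q) {f g : X ⟶ Y} {s t : A}
    (hf : f.hom.hom (p 1) = q s) (hg : g.hom.hom (p 1) = q t) :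
    stableRel Aᵐᵒᵖ f g ↔ ∃ c j, (∀ x, p x = 0 → c * x = 0) ∧ q j = 0 ∧ s - t = c + j := by
  have hfg : (f - g).hom.hom (p 1) = q (s - t) := by
    rw [map_sub, ← hf, ← hg]; rfl
  constructor
  · rintro ⟨P, a, b, hP, hab⟩
    -- Lifting `P → Y` through `q : A → Y` turns the factorization into one through `A`; the image
    -- of `p 1` in `A` is the required `c`.
    obtain ⟨l, hl⟩ := Module.projective_lifting_property q b.hom.hom hq
    have hl' : ∀ x, q (l x) = b.hom.hom x := fun x => LinearMap.congr_fun hl x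
    refine ⟨l (a.hom.hom (p 1)), s - t - l (a.hom.hom (p 1)), fun x hx => ?_, ?_, by abel⟩
    · rw [mul_eq_smul, ← map_smul, ← map_smul, ← map_mul_right, one_mul, hx, map_zero, map_zero]
    · rw [map_sub, hl', ← hfg, ← hab]
      exact sub_self _
  · rintro ⟨c, j, hc, hj, hcj⟩
    obtain ⟨a, ha⟩ := exists_linearMap_comp_eq hp (mulLeftHom c) hc
    refine ⟨FGModuleCat.of Aᵐᵒᵖ A, ObjectProperty.homMk (ModuleCat.ofHom a),
      ObjectProperty.homMk (ModuleCat.ofHom q), ?_, ?_⟩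
    · exact Module.Projective.of_equiv (MulOpposite.opLinearEquiv Aᵐᵒᵖ).symm
    · apply FGModuleCat.hom_ext
      apply LinearMap.ext
      intro y
      obtain ⟨x, rfl⟩ := hp y
      rw [linearMap_apply_eq hfg, hcj, add_mul, map_add, map_mul_right q j, hj, smul_zero, add_zero]
      exact congrArg q (ha x)

lemma exists_iso_of_unit {X Y : FGModuleCat.{v} Aᵐᵒᵖ} {p : A →ₗ[Aᵐᵒᵖ] X.obj}
    {q : A →ₗ[Aᵐᵒᵖ] Y.obj} (hp : Function.Surjective p) (hq : Function.Surjective q) (ξ : Aˣ)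
    (h : ∀ x, p x = 0 ↔ q (ξ * x) = 0) : ∃ θ : X ≅ Y, ∀ x, θ.hom.hom.hom (p x) = q (ξ * x) := by
  obtain ⟨f, hf⟩ := exists_linearMap_comp_eq hp (q ∘ₗ mulLeftHom (ξ : A)) fun x => (h x).1
  obtain ⟨g, hg⟩ := exists_linearMap_comp_eq hq (p ∘ₗ mulLeftHom ((ξ⁻¹ : Aˣ) : A)) fun x hx =>
    (h _).2 (by simpa using hx)
  refine ⟨⟨ObjectProperty.homMk (ModuleCat.ofHom f), ObjectProperty.homMk (ModuleCat.ofHom g),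
    ?_, ?_⟩, hf⟩
  · apply FGModuleCat.hom_ext
    apply LinearMap.ext
    intro y
    obtain ⟨x, rfl⟩ := hp y
    exact (congrArg g (hf x)).trans ((hg _).trans (by simp))
  · apply FGModuleCat.hom_ext
    apply LinearMap.ext
    intro y
    obtain ⟨x, rfl⟩ := hq y
    exact (congrArg f (hg x)).trans ((hf _).trans (by simp))

lemma exists_surjective_of_isCyclicModule {M : FGModuleCat.{v} Aᵐᵒᵖ}
    (hM : IsCyclicModule Aᵐᵒᵖ M) : ∃ p : A →ₗ[Aᵐᵒᵖ] M.obj, Function.Surjective p := by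
  obtain ⟨m, hm⟩ := hM
  refine ⟨{ toFun := fun x => (MulOpposite.op x • m : M.obj)
            map_add' := fun x y => by rw [MulOpposite.op_add, add_smul]
            map_smul' := fun r x => mul_smul r (MulOpposite.op x) m }, fun y => ?_⟩
  obtain ⟨r, hr⟩ := Submodule.mem_span_singleton.1
    (show y ∈ Submodule.span Aᵐᵒᵖ {m} from hm ▸ Submodule.mem_top)
  exact ⟨r.unop, hr⟩

end StableHom

/-! ### Natural isomorphisms and stable families -/

section Twist

variable {k : Type u} [Field k] {A : Type v} [Ring A] [Algebra k A] (φ : A ≃ₐ[k] A)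

/-- A presentation `A → M`, composed with `φ`, is a presentation of the restricted module. -/
def twistHom {M : FGModuleCat.{v} Aᵐᵒᵖ} (p : A →ₗ[Aᵐᵒᵖ] M.obj) :
    A →ₗ[Aᵐᵒᵖ] ((resFG (RingEquiv.op φ.toRingEquiv)).obj M).obj where
  toFun x := p (φ x)
  map_add' x y := by rw [map_add, map_add]; rfl
  map_smul' r x := by
    change p (φ (x * r.unop)) = _
    rw [map_mul, map_mul_right]
    rfl

lemma twistHom_apply {M : FGModuleCat.{v} Aᵐᵒᵖ} (p : A →ₗ[Aᵐᵒᵖ] M.obj) (x : A) :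
    twistHom φ p x = p (φ x) := rfl

lemma twistHom_surjective {M : FGModuleCat.{v} Aᵐᵒᵖ} {p : A →ₗ[Aᵐᵒᵖ] M.obj}
    (hp : Function.Surjective p) : Function.Surjective (twistHom φ p) :=
  hp.comp φ.surjective

/-- The two properties of a stable family, for a family indexed by all right ideals. -/
lemma IsStableFamily.exists_extension {ξ : ProperRightIdeal A → Aˣ} (h : IsStableFamily φ ξ) :
    ∃ ζ : Submodule Aᵐᵒᵖ A → Aˣ, (∀ I x, x ∈ I ↔ (ζ I : A) * x ∈ rightImage φ I) ∧
      ∀ I J, ∀ a ∈ colon k J I, φ a * (ζ I : A) - (ζ J : A) * a ∈ colon k ⊥ I ⊔ image φ J := by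
  classical
  let ζ : Submodule Aᵐᵒᵖ A → Aˣ := fun I => if hI : I ≠ ⊥ ∧ I ≠ ⊤ then ξ ⟨I, hI⟩ else 1
  have hζ : ∀ I (hI : I ≠ ⊥ ∧ I ≠ ⊤), ζ I = ξ ⟨I, hI⟩ := fun I hI => dif_pos hI
  have h1 : ∀ I x, x ∈ I ↔ (ζ I : A) * x ∈ rightImage φ I := by
    intro I x
    by_cases hI : I ≠ ⊥ ∧ I ≠ ⊤
    · rw [hζ I hI, ← mem_image_iff]
      change _ ↔ _ ∈ φ '' (I : Set A)
      rw [h.1 ⟨I, hI⟩]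
      constructor
      · exact fun hx => ⟨x, hx, rfl⟩
      · rintro ⟨y, hy, hxy⟩
        rwa [← (ξ ⟨I, hI⟩).mul_right_inj.1 hxy]
    · have : I = ⊥ ∨ I = ⊤ := by tauto
      rcases this with rfl | rfl
      · rw [mem_rightImage, Submodule.mem_bot, Submodule.mem_bot,
          map_eq_zero_iff _ φ.symm.injective, Units.mul_right_eq_zero]
      · exact iff_of_true Submodule.mem_top ((mem_rightImage φ).2 Submodule.mem_top)
  refine ⟨ζ, h1, fun I J a ha => ?_⟩
  rw [mem_colon_sup_image]
  have hmem : ∀ x ∈ I, φ a * ζ I * x ∈ rightImage φ J := fun x hx => by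
    rw [mul_assoc, mem_rightImage, map_mul, AlgEquiv.symm_apply_apply]
    exact ha _ ((h1 I x).1 hx)
  -- The added cases are automatic: for `I = 0` or `J = A` the sum `(0 : I) + φ(J)` is all of `A`,
  -- for `I = A` both terms lie in `φ(J)`, and for `J = 0` both kill `I`.
  by_cases hJ : J ≠ ⊥ ∧ J ≠ ⊤
  · by_cases hI : I ≠ ⊥ ∧ I ≠ ⊤
    · rw [hζ I hI, hζ J hJ, ← mem_colon_sup_image]
      exact h.2 ⟨I, hI⟩ ⟨J, hJ⟩ a ha
    · have : I = ⊥ ∨ I = ⊤ := by tauto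
      rcases this with rfl | rfl
      · exact ⟨_, 0, fun y hy => by rw [(Submodule.mem_bot _).1 hy, mul_zero], zero_mem _,
          (add_zero _).symm⟩
      · have ha' : a ∈ J := by simpa using ha 1 Submodule.mem_top
        exact ⟨0, _, fun _ _ => zero_mul _, sub_mem (by simpa using hmem 1 Submodule.mem_top)
          ((h1 J a).1 ha'), (zero_add _).symm⟩
  · have : J = ⊥ ∨ J = ⊤ := by tauto
    rcases this with rfl | rfl
    · refine ⟨_, 0, fun y hy => ?_, zero_mem _, (add_zero _).symm⟩
      have h2 : a * y = 0 := (Submodule.mem_bot _).1 (ha y hy)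
      have h3 := hmem y hy
      rw [mem_rightImage, Submodule.mem_bot, map_eq_zero_iff _ φ.symm.injective] at h3
      rw [sub_mul, h3, mul_assoc, h2, mul_zero, sub_zero]
    · exact ⟨0, _, fun _ _ => zero_mul _, (mem_rightImage φ).2 Submodule.mem_top,
        (zero_add _).symm⟩

lemma nonempty_iso_of_isStableFamily {ξ : ProperRightIdeal A → Aˣ} (h : IsStableFamily φ ξ) :
    Nonempty (resCyclic φ ≅ 𝟭 (StableCyclicCat Aᵐᵒᵖ)) := by
  obtain ⟨ζ, h1, h2⟩ := h.exists_extension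
  choose p hp using fun M : StableCyclicCat Aᵐᵒᵖ =>
    exists_surjective_of_isCyclicModule (M := M.obj.as) M.property
  have hp' := fun M => twistHom_surjective φ (hp M)
  -- The kernel is taken after twisting, so that `φ(K M)` is the kernel of `p M` itself.
  let K : StableCyclicCat Aᵐᵒᵖ → Submodule Aᵐᵒᵖ A := fun M => LinearMap.ker (twistHom φ (p M))
  have hK : ∀ M x, x ∈ rightImage φ (K M) ↔ p M x = 0 := fun M x => by
    rw [mem_rightImage, LinearMap.mem_ker, twistHom_apply, AlgEquiv.apply_symm_apply]
    rfl
  choose θ hθ using fun M => exists_iso_of_unit (hp' M) (hp M) (ζ (K M)) fun x =>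
    (h1 (K M) x).trans (hK M _)
  refine ⟨NatIso.ofComponents (fun M => (stableCyclic Aᵐᵒᵖ).isoMk
    ((CategoryTheory.Quotient.functor (stableRel Aᵐᵒᵖ)).mapIso (θ M))) ?_⟩
  rintro M N ⟨f⟩
  obtain ⟨f, rfl⟩ := (CategoryTheory.Quotient.functor (stableRel Aᵐᵒᵖ)).map_surjective f
  apply ObjectProperty.hom_ext
  change (CategoryTheory.Quotient.functor (stableRel Aᵐᵒᵖ)).map
      ((resFG (RingEquiv.op φ.toRingEquiv)).map f ≫ (θ N).hom) =
    (CategoryTheory.Quotient.functor (stableRel Aᵐᵒᵖ)).map ((θ M).hom ≫ f)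
  apply CategoryTheory.Quotient.sound
  obtain ⟨b, hb⟩ := hp N (f.hom.hom (p M 1))
  obtain ⟨a, rfl⟩ := φ.surjective b
  have ha : a ∈ colon k (K N) (K M) := fun x hx => by
    change p N (φ (a * x)) = 0
    rw [map_mul, ← linearMap_apply_eq hb.symm]
    have e1 : p M (φ x) = 0 := LinearMap.mem_ker.1 hx
    rw [e1, map_zero]
  obtain ⟨c, j, hc, hj, hcj⟩ := (mem_colon_sup_image φ).1 (h2 (K M) (K N) a ha)
  refine (stableRel_iff (hp' M) (hp N) (s := ζ (K N) * a) (t := φ a * ζ (K M)) ?_ ?_).2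
    ⟨-c, -j, fun x hx => by rw [neg_mul, hc x hx, neg_zero],
      by rw [map_neg, (hK N j).1 hj, neg_zero], by rw [← neg_sub, hcj, neg_add]⟩
  · have e1 : f.hom.hom (p M (φ 1)) = twistHom φ (p N) a := by rw [map_one]; exact hb.symm
    exact (congrArg (θ N).hom.hom.hom e1).trans (hθ N a)
  · have e1 : (θ M).hom.hom.hom (twistHom φ (p M) 1) = p M (ζ (K M)) := by rw [hθ, mul_one]
    exact (congrArg f.hom.hom e1).trans (linearMap_apply_eq hb.symm _)

/-- The cyclic module `A/I`, as an object of the stable category. -/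
def cyclicQuotient (I : Submodule Aᵐᵒᵖ A) : StableCyclicCat Aᵐᵒᵖ :=
  ⟨⟨FGModuleCat.of Aᵐᵒᵖ (A ⧸ I)⟩, ⟨(Submodule.Quotient.mk 1 : A ⧸ I), eq_top_iff.2 fun y _ => by
    obtain ⟨x, rfl⟩ := Submodule.Quotient.mk_surjective I y
    exact Submodule.mem_span_singleton.2 ⟨MulOpposite.op x, by
      rw [← Submodule.Quotient.mk_smul, ← mul_eq_smul, one_mul]⟩⟩⟩

/-- The presentation of `A/I`. -/
def cyclicQuotientMk (I : Submodule Aᵐᵒᵖ A) : A →ₗ[Aᵐᵒᵖ] (cyclicQuotient I).obj.as.obj := I.mkQ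

lemma cyclicQuotientMk_surjective (I : Submodule Aᵐᵒᵖ A) :
    Function.Surjective (cyclicQuotientMk I) := I.mkQ_surjective

lemma cyclicQuotientMk_eq_zero {I : Submodule Aᵐᵒᵖ A} {x : A} : cyclicQuotientMk I x = 0 ↔ x ∈ I :=
  Submodule.Quotient.mk_eq_zero I

lemma twistHom_cyclicQuotientMk_eq_zero {I : Submodule Aᵐᵒᵖ A} {x : A} :
    twistHom φ (cyclicQuotientMk (rightImage φ I)) x = 0 ↔ x ∈ I :=
  cyclicQuotientMk_eq_zero.trans (apply_mem_rightImage φ)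

lemma exists_family_of_iso (η : resCyclic φ ≅ 𝟭 (StableCyclicCat Aᵐᵒᵖ)) :
    ∃ a b : Submodule Aᵐᵒᵖ A → A, (∀ I, IsStableInverse I (rightImage φ I) (a I) (b I)) ∧
      ∀ I J, ∀ c ∈ colon k J I, φ c * a I - a J * c ∈ colon k ⊥ I ⊔ image φ J := by
  let Q := CategoryTheory.Quotient.functor (stableRel Aᵐᵒᵖ)
  -- Evaluating at `A/φ(I)` makes the twisted presentation have kernel exactly `I`.
  let C := fun I : Submodule Aᵐᵒᵖ A => cyclicQuotient (rightImage φ I)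
  let q := fun I : Submodule Aᵐᵒᵖ A => cyclicQuotientMk (rightImage φ I)
  let p := fun I : Submodule Aᵐᵒᵖ A => twistHom φ (q I)
  have hq : ∀ I, Function.Surjective (q I) := fun I => cyclicQuotientMk_surjective _
  have hp : ∀ I, Function.Surjective (p I) := fun I => twistHom_surjective φ (hq I)
  let F := resFG (RingEquiv.op φ.toRingEquiv)
  choose h hh using fun I => Q.map_surjective (X := F.obj (C I).obj.as) (Y := (C I).obj.as)
    (η.hom.app (C I)).hom
  choose h' hh' using fun I => Q.map_surjective (X := (C I).obj.as) (Y := F.obj (C I).obj.as)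
    (η.inv.app (C I)).hom
  choose a ha using fun I => hq I ((h I).hom.hom (p I 1))
  choose b hb using fun I => hp I ((h' I).hom.hom (q I 1))
  refine ⟨a, b, fun I => ⟨fun x hx => ?_, fun x hx => ?_, ?_⟩, fun I J c hc => ?_⟩
  · rw [← cyclicQuotientMk_eq_zero]
    change q I _ = 0
    rw [← linearMap_apply_eq (ha I).symm, (twistHom_cyclicQuotientMk_eq_zero φ).2 hx, map_zero]
  · rw [← twistHom_cyclicQuotientMk_eq_zero φ]
    change p I _ = 0
    rw [← linearMap_apply_eq (hb I).symm, cyclicQuotientMk_eq_zero.2 hx, map_zero]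
  · have hid : Q.map (h' I ≫ h I) = Q.map (𝟙 (C I).obj.as) := by
      rw [Q.map_comp, hh, hh', Q.map_id]
      exact (stableCyclic Aᵐᵒᵖ).ι.congr_map (η.inv_hom_id_app (C I))
    obtain ⟨c, j, hc, hj, hcj⟩ := (stableRel_iff (hq I) (hq I) (s := a I * b I) (t := 1)
      ((congrArg (h I).hom.hom (hb I).symm).trans (linearMap_apply_eq (ha I).symm _)) rfl).1
      ((CategoryTheory.Quotient.functor_map_eq_iff _ _ _).1 hid)
    exact ⟨c, j, fun x hx => hc x (cyclicQuotientMk_eq_zero.2 hx), cyclicQuotientMk_eq_zero.1 hj,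
      by rw [add_assoc, ← hcj]; abel⟩
  · obtain ⟨g, hg⟩ := exists_linearMap_comp_eq (hq I) (q J ∘ₗ mulLeftHom (φ c)) fun x hx => by
      refine cyclicQuotientMk_eq_zero.2 ?_
      rw [mulLeftHom_apply, mem_rightImage, map_mul, AlgEquiv.symm_apply_apply]
      exact hc _ (cyclicQuotientMk_eq_zero.1 hx : x ∈ rightImage φ I)
    let G : (C I).obj.as ⟶ (C J).obj.as := ObjectProperty.homMk (ModuleCat.ofHom g)
    have hnat : Q.map (h I ≫ G) = Q.map (F.map G ≫ h J) := by
      rw [Q.map_comp, Q.map_comp, hh, hh]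
      exact ((stableCyclic Aᵐᵒᵖ).ι.congr_map
        (η.hom.naturality (ObjectProperty.homMk (Q.map G) : C I ⟶ C J))).symm
    obtain ⟨m, j, hm, hj, hmj⟩ := (stableRel_iff (hp I) (hq J) (s := φ c * a I) (t := a J * c)
      ((congrArg g (ha I).symm).trans (hg _)) (by
        have e1 : g (q I (φ 1)) = p J c := by
          rw [map_one, hg, LinearMap.comp_apply, mulLeftHom_apply, mul_one]
          rfl
        exact (congrArg (h J).hom.hom e1).trans (linearMap_apply_eq (ha J).symm _))).1
      ((CategoryTheory.Quotient.functor_map_eq_iff _ _ _).1 hnat)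
    exact (mem_colon_sup_image φ).2 ⟨m, j,
      fun x hx => hm x ((twistHom_cyclicQuotientMk_eq_zero φ).2 hx),
      cyclicQuotientMk_eq_zero.1 hj, hmj⟩

end Twist

end StableModule

open StableModule in
theorem theorem2 {k : Type u} [Field k] {A : Type v} [Ring A] [Algebra k A] [Module.Finite k A]
    (hA : StableModule.IsSelfInjective A) (hblocks : StableModule.WithoutSemisimpleBlocks k A)
    (φ : A ≃ₐ[k] A) :
    (Nonempty (StableModule.resCyclic φ ≅ 𝟭 (StableModule.StableCyclicCat Aᵐᵒᵖ)) ↔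
      ∃ ξ : StableModule.ProperRightIdeal A → Aˣ, StableModule.IsStableFamily φ ξ) ∧
    ∀ ξ ξ' : StableModule.ProperRightIdeal A → Aˣ, StableModule.IsStableFamily φ ξ →
      (∀ I : StableModule.ProperRightIdeal A,
        (ξ I : A) - (ξ' I : A) ∈
          StableModule.colon k ⊥ I.1 ⊔ StableModule.image φ I.1) →
      StableModule.IsStableFamily φ ξ' := by
  have : IsArtinianRing A := .of_finite k A
  refine ⟨⟨?_, fun ⟨ξ, h⟩ => nonempty_iso_of_isStableFamily φ h⟩, fun ξ ξ' h hξ => ?_⟩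
  · rintro ⟨η⟩
    obtain ⟨a, b, h, hnat⟩ := exists_family_of_iso φ η
    choose ξ hξ using exists_unit_of_isStableInverse φ
      (fun _ => mem_jacobson_of_mul_jacobson_eq_zero hA hblocks)
      (a := fun I => a I.1) (b := fun I => b I.1) fun I => h I.1
    exact ⟨ξ, isStableFamily_of_sub_mem φ (fun I => (h I.1).mul_mem)
      (fun I J => hnat I.1 J.1) hξ⟩
  · refine isStableFamily_of_sub_mem φ (a := fun I => (ξ I : A)) (fun I x hx => ?_) h.2 fun I => by
      rw [← neg_sub]; exact neg_mem (hξ I)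
    rw [← mem_image_iff]
    change _ ∈ φ '' (I.1 : Set A)
    rw [h.1 I]
    exact ⟨x, hx, rfl⟩
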